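/- Let $\{\epsilon_t : t\ge 1\}$ be a strictly stationary real-valued series with $E\epsilon_1=0$ and $E|\epsilon_1|^4<\infty$ such that the series $\sum_{t\ge1}\mathrm{Cov}(\epsilon_1^2,\epsilon_{1+t}^2)$ converges and, for constants $0<\eta,\eta'<\infty$ and standard Brownian motions $B$, $B^{(2)}$ started at $0$, $$T^{-1/2}\sum_{i\le\lfloor Ts\rfloor}\epsilon_i\Rightarrow\eta B(s),\qquad T^{-1/2}\sum_{i\le\lfloor Ts\rfloor}(\epsilon_i^2-E\epsilon_i^2)\Rightarrow\eta' B^{(2)}(s),\qquad T\to\infty,$$ weakly in the space $D[0,1]$ of cadlag functions with the Skorokhod metric. Let $Y_0=0$ and $Y_t=Y_{t-1}+\epsilon_t$ for $t\ge1$. Put $\sigma^2=\mathrm{Var}(\epsilon_1)$ and $\vartheta=\eta/\sigma$ (the hypotheses force $\sigma>0$). Let $K:\mathbb R\to[0,\infty)$ be a bounded $C^2$ function with bounded derivative and bounded variation on $\mathbb R$, such that $K$ and $z\mapsto zK(z)$ are Lebesgue integrable, $\int K(z)\,dz=1$ and $\int zK(z)\,dz=0$. Let $h_T>0$ $(T\ge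 1)$ satisfy $T/h_T\to\zeta$ for some $1\le\zeta<\infty$. For $s\in[0,1]$ let $$D_T(s)=\frac{\lfloor Ts\rfloor^{-1}\sum_{t=1}^{\lfloor Ts\rfloor}Y_{t-1}(Y_t-Y_{t-1})\,K\big((\lfloor Ts\rfloor-t)/h_T\big)}{\lfloor Ts\rfloor^{-2}\sum_{t=1}^{\lfloor Ts\rfloor}Y_{t-1}^2},\qquad 0/0:=0,$$ where $D_T(s):=0$ if $\lfloor Ts\rfloor=0$. Then for every $\kappa\in(0,1)$, $$D_T\Rightarrow\mathcal D_\vartheta\quad\text{weakly in } D[\kappa,1]\text{ with the Skorokhod metric, as }T\to\infty,$$ where $\mathcal D_\vartheta(0)=0$ and, for $s\in(0,1]$, $$\mathcal D_\vartheta(s)=\frac{\frac s2\left\{K(0)B(s)^2+\zeta\int_0^sB(r)^2K'(\zeta(s-r))\,dr-\vartheta^{-2}\int_0^sK(\zeta(s-r))\,dr\right\}}{\int_0^sB(r)^2\,dr}.$$ Moreover, with probability one $\mathcal D_\vartheta$ is continuous on $(0,1]$. -/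

import Mathlib

open MeasureTheory ProbabilityTheory Filter Topology Set
open scoped NNReal ENNReal

noncomputable section

/-! ### The Skorokhod space -/

/-- A real function on the compact interval `[a, b]` is cadlag if it is right-continuous and
has a (finite) left limit at every point. (At the left end point `𝓝[<] t` is trivial, so nothing
is required of the left limit there, and right-continuity is void at the right end point.) -/
def IsCadlag {a b : ℝ} (f : Icc a b → ℝ) : Prop :=
  ∀ t : Icc a b, ContinuousWithinAt f (Ici t) t ∧ ∃ l : ℝ, Tendsto f (𝓝[<] t) (𝓝 l)

/-- The set `D[a, b]` of all cadlag functions on `[a, b]`. -/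
def SkorokhodSpace (a b : ℝ) : Type := {f : Icc a b → ℝ // IsCadlag f}

namespace SkorokhodSpace

variable {a b : ℝ}

/-- The Skorokhod distance: the infimum over all increasing bijections `u` of `[a, b]`
of the maximum of `sup |u t - t|` and `sup |f t - g (u t)|`. It is written as an extended distance
so that no separate argument is needed for the finiteness of the suprema. -/
def skorokhodEDist (f g : SkorokhodSpace a b) : ℝ≥0∞ :=
  ⨅ u : Icc a b ≃o Icc a b,
    max (⨆ t : Icc a b, edist (u t) t) (⨆ t : Icc a b, edist (f.1 t) (g.1 (u t)))

theorem skorokhodEDist_self (f : SkorokhodSpace a b) : skorokhodEDist f f = 0 := by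
  refine le_antisymm ?_ bot_le
  refine (iInf_le _ (OrderIso.refl _)).trans ?_
  simp

theorem skorokhodEDist_comm_le (f g : SkorokhodSpace a b) :
    skorokhodEDist f g ≤ skorokhodEDist g f := by
  refine le_iInf fun u => (iInf_le _ u.symm).trans ?_
  refine max_le_max ?_ ?_
  · refine iSup_le fun t => ?_
    refine le_trans ?_ (le_iSup (fun t : Icc a b => edist (u t) t) (u.symm t))
    simp [edist_comm]
  · refine iSup_le fun t => ?_
    refine le_trans ?_ (le_iSup (fun t : Icc a b => edist (g.1 t) (f.1 (u t))) (u.symm t))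
    simp [edist_comm]

theorem skorokhodEDist_triangle (f g k : SkorokhodSpace a b) :
    skorokhodEDist f k ≤ skorokhodEDist f g + skorokhodEDist g k := by
  refine ENNReal.le_iInf_add_iInf fun u v => (iInf_le _ (u.trans v)).trans ?_
  refine max_le ?_ ?_
  · refine iSup_le fun t => ?_
    have h1 : edist (u t) t ≤ ⨆ t : Icc a b, edist (u t) t :=
      le_iSup (fun t : Icc a b => edist (u t) t) t
    have h2 : edist (v (u t)) (u t) ≤ ⨆ t : Icc a b, edist (v t) t :=
      le_iSup (fun t : Icc a b => edist (v t) t) (u t)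
    have h3 := edist_triangle (v (u t)) (u t) t
    rw [add_comm] at h3
    exact h3.trans (add_le_add (h1.trans (le_max_left _ _)) (h2.trans (le_max_left _ _)))
  · refine iSup_le fun t => ?_
    have h1 : edist (f.1 t) (g.1 (u t)) ≤ ⨆ t : Icc a b, edist (f.1 t) (g.1 (u t)) :=
      le_iSup (fun t : Icc a b => edist (f.1 t) (g.1 (u t))) t
    have h2 : edist (g.1 (u t)) (k.1 (v (u t))) ≤ ⨆ t : Icc a b, edist (g.1 t) (k.1 (v t)) :=
      le_iSup (fun t : Icc a b => edist (g.1 t) (k.1 (v t))) (u t)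
    exact (edist_triangle _ _ _).trans
      (add_le_add (h1.trans (le_max_right _ _)) (h2.trans (le_max_right _ _)))

instance : PseudoEMetricSpace (SkorokhodSpace a b) where
  edist := skorokhodEDist
  edist_self := skorokhodEDist_self
  edist_comm f g := le_antisymm (skorokhodEDist_comm_le f g) (skorokhodEDist_comm_le g f)
  edist_triangle := skorokhodEDist_triangle

/-- `D[a, b]` carries the Borel σ-algebra of the Skorokhod topology. -/
instance : MeasurableSpace (SkorokhodSpace a b) := borel _

instance : BorelSpace (SkorokhodSpace a b) := ⟨rfl⟩

open Classical in
/-- The restriction of a path `x : ℝ → ℝ` to `[a, b]` as an element of `D[a, b]`, with the value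
`0` if that restriction is not cadlag. It is only used for paths that are almost surely cadlag,
see `WeaklyConverges`. -/
def ofPath (a b : ℝ) (x : ℝ → ℝ) : SkorokhodSpace a b :=
  if h : IsCadlag (fun t : Icc a b => x t) then ⟨_, h⟩
  else ⟨fun _ => 0, fun _ => ⟨continuousWithinAt_const, 0, tendsto_const_nhds⟩⟩

end SkorokhodSpace

/-- Weak convergence `X n ⇒ Z` in `(D[a, b], d)` as `n → ∞`, for real-valued
processes `X n` (on a probability space `(Ω, P)`) and `Z` (on a probability space `(Ω', P')`) whose
paths are almost surely cadlag on `[a, b]`: weak convergence of the laws on `D[a, b]`. -/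
structure WeaklyConverges (a b : ℝ) {Ω Ω' : Type*} [MeasurableSpace Ω] [MeasurableSpace Ω']
    (X : ℕ → Ω → ℝ → ℝ) (P : Measure Ω) [IsProbabilityMeasure P]
    (Z : Ω' → ℝ → ℝ) (P' : Measure Ω') [IsProbabilityMeasure P'] : Prop where
  cadlag : ∀ n, ∀ᵐ ω ∂P, IsCadlag (fun t : Icc a b => X n ω t)
  cadlag_limit : ∀ᵐ ω ∂P', IsCadlag (fun t : Icc a b => Z ω t)
  tendsto : TendstoInDistribution (fun n ω => SkorokhodSpace.ofPath a b (X n ω)) atTop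
    (fun ω => SkorokhodSpace.ofPath a b (Z ω)) (fun _ => P) P'

/-! ### The error terms -/

/-- Strict stationarity of the series `ε 1, ε 2, …` (the value `ε 0` plays no role): all
finite-dimensional distributions are invariant under time shifts. -/
def IsStrictlyStationary {Ω : Type*} [MeasurableSpace Ω] (ε : ℕ → Ω → ℝ) (P : Measure Ω) : Prop :=
  ∀ (n : ℕ) (t : Fin n → ℕ) (k : ℕ), (∀ i, 1 ≤ t i) →
    IdentDistrib (fun ω i => ε (t i) ω) (fun ω i => ε (t i + k) ω) P P

/-- The partial sum process `s ↦ T^{-1/2} ∑_{1 ≤ i ≤ ⌊T s⌋} ξ_i`. -/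
def partialSumProcess {Ω : Type*} (ξ : ℕ → Ω → ℝ) (T : ℕ) (ω : Ω) (s : ℝ) : ℝ :=
  (√(T : ℝ))⁻¹ * ∑ i ∈ Finset.Icc 1 ⌊(T : ℝ) * s⌋₊, ξ i ω

/-- The paths `s ↦ c B(s)`, `s ≥ 0`, of a scaled process. -/
def scaledPath {Ω : Type*} (c : ℝ) (B : ℝ≥0 → Ω → ℝ) (ω : Ω) (s : ℝ) : ℝ :=
  c * B s.toNNReal ω

/-- The assumption on the error terms `ε 1, ε 2, …`, with `η`, `η'` the scale
parameters of the two functional central limit theorems and `B`, `B₂` the limiting processes. -/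
structure ErrorAssumption {Ω Ω₁ Ω₂ : Type*} [MeasurableSpace Ω] [MeasurableSpace Ω₁]
    [MeasurableSpace Ω₂] (ε : ℕ → Ω → ℝ) (P : Measure Ω) [IsProbabilityMeasure P] (η η' : ℝ)
    (B : ℝ≥0 → Ω₁ → ℝ) (P₁ : Measure Ω₁) [IsProbabilityMeasure P₁]
    (B₂ : ℝ≥0 → Ω₂ → ℝ) (P₂ : Measure Ω₂) [IsProbabilityMeasure P₂] : Prop where
  measurable : ∀ t, 1 ≤ t → Measurable (ε t)
  stationary : IsStrictlyStationary ε P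
  moment : MemLp (ε 1) 4 P
  mean_zero : ∫ ω, ε 1 ω ∂P = 0
  /-- The series `∑_{t ≥ 1} Cov(ε_1², ε_{1+t}²)` converges. -/
  cov_series : ∃ L : ℝ, Tendsto
    (fun N : ℕ => ∑ t ∈ Finset.Icc 1 N, cov[fun ω => ε 1 ω ^ 2, fun ω => ε (1 + t) ω ^ 2; P])
    atTop (𝓝 L)
  η_pos : 0 < η
  η'_pos : 0 < η'
  fclt : WeaklyConverges 0 1 (partialSumProcess ε) P (scaledPath η B) P₁
  fclt_sq : WeaklyConverges 0 1
    (partialSumProcess fun t ω => ε t ω ^ 2 - ∫ ω', ε t ω' ^ 2 ∂P) P (scaledPath η' B₂) P₂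

/-- The AR(1) model `Y_0 = 0`, `Y_t = ρ Y_{t-1} + ε_t` for `t ≥ 1`. -/
structure IsAR1 {Ω : Type*} (ρ : ℝ) (Y ε : ℕ → Ω → ℝ) : Prop where
  zero : ∀ ω, Y 0 ω = 0
  step : ∀ t, 1 ≤ t → ∀ ω, Y t ω = ρ * Y (t - 1) ω + ε t ω

/-! ### The kernel, the weighted Dickey-Fuller process and its limit -/

/-- The assumptions on the smoothing kernel. -/
structure KernelAssumption (K : ℝ → ℝ) : Prop where
  nonneg : ∀ z, 0 ≤ K z
  bounded : ∃ C, ∀ z, |K z| ≤ C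
  integrable : Integrable K
  integral_eq_one : ∫ z, K z = 1
  integrable_mul : Integrable fun z => z * K z
  integral_mul_eq_zero : ∫ z, z * K z = 0
  contDiff : ContDiff ℝ 2 K
  deriv_bounded : ∃ C, ∀ z, |deriv K z| ≤ C
  boundedVariation : BoundedVariationOn K univ

/-- The sequential kernel-weighted Dickey-Fuller process with `n = ⌊T s⌋`:
`D_T(s) = n⁻¹ ∑_{t=1}^n Y_{t-1} (Y_t - Y_{t-1}) K((n - t) / h) / (n⁻² ∑_{t=1}^n Y_{t-1}²)`,
where `0 / 0 = 0`. -/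
def dickeyFullerProcess {Ω : Type*} (K : ℝ → ℝ) (h : ℝ) (Y : ℕ → Ω → ℝ) (T : ℕ)
    (ω : Ω) (s : ℝ) : ℝ :=
  let n : ℕ := ⌊(T : ℝ) * s⌋₊
  ((n : ℝ)⁻¹ * ∑ t ∈ Finset.Icc 1 n,
      Y (t - 1) ω * (Y t ω - Y (t - 1) ω) * K (((n : ℝ) - (t : ℝ)) / h)) /
    (((n : ℝ) ^ 2)⁻¹ * ∑ t ∈ Finset.Icc 1 n, Y (t - 1) ω ^ 2)

/-- The limit process `𝒟_ϑ(s)`, `0 < s ≤ 1`, with `𝒟_ϑ(0) = 0`, built from the process `B`. -/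
def limitProcess {Ω : Type*} (K : ℝ → ℝ) (ζ ϑ : ℝ) (B : ℝ≥0 → Ω → ℝ) (ω : Ω) (s : ℝ) : ℝ :=
  if s = 0 then 0 else
  (s / 2 * (K 0 * B s.toNNReal ω ^ 2
      + ζ * (∫ r in (0 : ℝ)..s, B r.toNNReal ω ^ 2 * deriv K (ζ * (s - r)))
      - (ϑ ^ 2)⁻¹ * (∫ r in (0 : ℝ)..s, K (ζ * (s - r))))) /
    ∫ r in (0 : ℝ)..s, B r.toNNReal ω ^ 2

end

/-! ### Step functions and uniform convergence in the Skorokhod space -/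

/-! The numerator of `D_T` looks like a stochastic integral, but it is a pathwise functional of
partial sums. Put `Q_n = T⁻¹ (Y_n² - ∑_{i ≤ n} ε_i²)`. Since `2 Y_{t-1} ε_t = Y_t² - Y_{t-1}² -
ε_t²`, the increments of `Q` are `2 T⁻¹ Y_{t-1} ε_t`. Summation by parts moves the difference from
`Q` onto the smooth kernel, whose increments are exact integrals of `K'`. So `D_T` is an explicit
ratio of integrals of step paths built from `W_T = T^{-1/2} Y_{⌊T·⌋}` and `Q`
(`dickeyFullerProcess_eq_stepRatio`, `stepRatio_eq`).

With `v = E ε_1²`, the path of `Q` is `W_T² - v ⌊Ts⌋/T` minus `T^{-1/2}` times the partial sum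
process of the centred squares. The latter process is bounded in probability because it converges in
distribution, so this remainder vanishes uniformly in probability. Joint convergence of the two
partial sum processes is therefore not needed.

For deterministic paths, uniform convergence of both inputs to continuous limits gives uniform
convergence of the ratio on `[κ, 1]`, provided the limiting denominators do not vanish
(`tendstoUniformlyOn_stepRatio`); for Brownian motion this holds almost surely
(`ae_integral_sq_pos`). Skorokhod convergence to a continuous limit is uniform, so an extended
continuous mapping theorem (`of_tendsto_comap`) transfers the deterministic statement to laws. The
limit is the ratio for `w = η B` and `q = w² - v r`; integrating the drift by parts and dividing by
`η²` yields `𝒟_ϑ`. -/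

/-- A step path `s ↦ v ⌊T s⌋` is cadlag. -/
theorem isCadlag_comp_natFloor_mul {a b : ℝ} (T : ℕ) (v : ℕ → ℝ) :
    IsCadlag (fun s : Icc a b => v ⌊(T : ℝ) * s⌋₊) := by
  intro t
  simp_rw [← Int.floor_toNat]
  rcases Nat.eq_zero_or_pos T with rfl | hT
  · simp only [CharP.cast_eq_zero, zero_mul]
    exact ⟨continuousWithinAt_const, _, tendsto_const_nhds⟩
  have hT' : (0 : ℝ) < T := by exact_mod_cast hT
  have hc : Tendsto (fun s : Icc a b => (T : ℝ) * s) (𝓝 t) (𝓝 ((T : ℝ) * t)) :=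
    (continuous_const.mul continuous_subtype_val).tendsto t
  have hr : Tendsto (fun s : Icc a b => (T : ℝ) * s) (𝓝[≥] t) (𝓝[≥] ((T : ℝ) * t)) := by
    refine tendsto_nhdsWithin_iff.2 ⟨hc.mono_left nhdsWithin_le_nhds, ?_⟩
    filter_upwards [self_mem_nhdsWithin] with s hs
    exact mul_le_mul_of_nonneg_left (show (t : ℝ) ≤ s from hs) hT'.le
  have hl : Tendsto (fun s : Icc a b => (T : ℝ) * s) (𝓝[<] t) (𝓝[<] ((T : ℝ) * t)) := by
    refine tendsto_nhdsWithin_iff.2 ⟨hc.mono_left nhdsWithin_le_nhds, ?_⟩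
    filter_upwards [self_mem_nhdsWithin] with s hs
    exact mul_lt_mul_of_pos_left (show (s : ℝ) < t from hs) hT'
  constructor
  · refine tendsto_nhds_of_eventually_eq ?_
    have := tendsto_pure.1 ((tendsto_floor_right_pure_floor _).comp hr)
    filter_upwards [this] with s hs
    simp only [Function.comp_apply] at hs
    rw [hs]
  -- Just to the left of `t` the integer floor of `T s` is constantly `⌈T t⌉ - 1`. This may be
  -- negative, and `toNat` then truncates it to `0`, as the natural floor does.
  · refine ⟨v (⌈(T : ℝ) * t⌉ - 1).toNat, tendsto_nhds_of_eventually_eq ?_⟩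
    have := tendsto_pure.1 ((tendsto_floor_left_pure_ceil_sub_one _).comp hl)
    filter_upwards [this] with s hs
    simp only [Function.comp_apply] at hs
    rw [hs]

theorem Continuous.isCadlag {a b : ℝ} {f : Icc a b → ℝ} (hf : Continuous f) : IsCadlag f :=
  fun t => ⟨hf.continuousWithinAt, f t, (hf.tendsto t).mono_left nhdsWithin_le_nhds⟩

namespace SkorokhodSpace

variable {a b : ℝ}

theorem ofPath_val {x : ℝ → ℝ} (hx : IsCadlag fun t : Icc a b => x t) :
    (ofPath a b x).1 = fun t : Icc a b => x t := by
  simp [ofPath, hx]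

theorem ofPath_val_of_not {x : ℝ → ℝ} (hx : ¬ IsCadlag fun t : Icc a b => x t) :
    (ofPath a b x).1 = fun _ => 0 := by
  simp [ofPath, hx]

theorem ofPath_congr {x y : ℝ → ℝ} (h : ∀ t ∈ Icc a b, x t = y t) :
    ofPath a b x = ofPath a b y := by
  have : (fun t : Icc a b => x t) = fun t : Icc a b => y t := funext fun t => h t t.2
  by_cases hx : IsCadlag fun t : Icc a b => x t
  · have hy : IsCadlag fun t : Icc a b => y t := this ▸ hx
    exact Subtype.ext ((ofPath_val hx).trans (this.trans (ofPath_val hy).symm))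
  · have hy : ¬ IsCadlag fun t : Icc a b => y t := this ▸ hx
    exact Subtype.ext ((ofPath_val_of_not hx).trans (ofPath_val_of_not hy).symm)

theorem edist_le_iSup (f g : SkorokhodSpace a b) :
    edist f g ≤ ⨆ t : Icc a b, edist (f.1 t) (g.1 t) := by
  refine (iInf_le _ (OrderIso.refl _)).trans ?_
  simp

/-- A time change leaves the zero path unchanged, so it cannot bring `x` closer to it. Tightness in
the Skorokhod space thus controls the sup norm. -/
theorem edist_ofPath_zero {x : ℝ → ℝ} (hx : IsCadlag fun t : Icc a b => x t) :
    edist (ofPath a b x) (ofPath a b 0) = ⨆ t : Icc a b, edist (x t) 0 := by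
  have h0 : IsCadlag fun t : Icc a b => (0 : ℝ → ℝ) t := Continuous.isCadlag continuous_const
  refine le_antisymm ?_ (le_iInf fun u => le_trans ?_ (le_max_right _ _))
  · refine (edist_le_iSup _ _).trans ?_
    rw [ofPath_val hx, ofPath_val h0]
    rfl
  · rw [ofPath_val hx, ofPath_val h0]
    rfl

/-- Uniform convergence of cadlag paths implies convergence in the Skorokhod topology. -/
theorem tendsto_ofPath {ι : Type*} {l : Filter ι} {x : ι → ℝ → ℝ} {y : ℝ → ℝ}
    (hx : ∀ᶠ i in l, IsCadlag fun t : Icc a b => x i t) (hy : IsCadlag fun t : Icc a b => y t)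
    (h : TendstoUniformlyOn x y l (Icc a b)) :
    Tendsto (fun i => ofPath a b (x i)) l (𝓝 (ofPath a b y)) := by
  refine EMetric.tendsto_nhds.2 fun δ hδ => ?_
  obtain ⟨δ', hδ', hlt⟩ := exists_between hδ
  filter_upwards [hx, EMetric.tendstoUniformlyOn_iff.1 h δ' hδ'] with i hi hi'
  refine (edist_le_iSup _ _).trans_lt (lt_of_le_of_lt (iSup_le fun t => ?_) hlt)
  rw [ofPath_val hi, ofPath_val hy, edist_comm]
  exact (hi' t t.2).le

/-- Convergence to a continuous function in the Skorokhod topology is uniform. -/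
theorem tendstoUniformlyOn_of_tendsto_ofPath {ι : Type*} {l : Filter ι} {x : ι → ℝ → ℝ} {y : ℝ → ℝ}
    (hx : ∀ᶠ i in l, IsCadlag fun t : Icc a b => x i t) (hy : ContinuousOn y (Icc a b))
    (h : Tendsto (fun i => ofPath a b (x i)) l (𝓝 (ofPath a b y))) :
    TendstoUniformlyOn x y l (Icc a b) := by
  have hyc : Continuous fun t : Icc a b => y t := continuousOn_iff_continuous_domRestrict.1 hy
  have hyu := CompactSpace.uniformContinuous_of_continuous hyc
  refine EMetric.tendstoUniformlyOn_iff.2 fun δ hδ => ?_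
  obtain ⟨δ', hδ', hu⟩ := EMetric.uniformContinuous_iff.1 hyu (δ / 2)
    (ENNReal.half_pos hδ.ne')
  filter_upwards [hx, EMetric.tendsto_nhds.1 h (min δ' (δ / 2))
    (lt_min hδ' (ENNReal.half_pos hδ.ne'))] with i hi hi' t ht
  -- The time change `u` is uniformly close to the identity, so uniform continuity of `y` absorbs
  -- it.
  obtain ⟨u, hu'⟩ := iInf_lt_iff.1 (show skorokhodEDist _ _ < _ from hi')
  rw [ofPath_val hi, ofPath_val hyc.isCadlag] at hu'
  obtain ⟨h1, h2⟩ := max_lt_iff.1 hu'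
  have h1' : edist (u ⟨t, ht⟩) (⟨t, ht⟩ : Icc a b) < δ' :=
    (le_iSup (fun t : Icc a b => edist (u t) t) ⟨t, ht⟩).trans_lt (h1.trans_le (min_le_left _ _))
  have h2' : edist (x i t) (y (u ⟨t, ht⟩)) < δ / 2 :=
    (le_iSup (fun t : Icc a b => edist (x i t) (y (u t))) ⟨t, ht⟩).trans_lt
      (h2.trans_le (min_le_right _ _))
  calc edist (y t) (x i t) ≤ edist (y t) (y (u ⟨t, ht⟩)) + edist (y (u ⟨t, ht⟩)) (x i t) :=
        edist_triangle _ _ _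
    _ < δ / 2 + δ / 2 := by
        rw [edist_comm (y t), edist_comm _ (x i t)]
        exact ENNReal.add_lt_add (hu h1') h2'
    _ = δ := ENNReal.add_halves δ

theorem continuous_ofPath_comp_natFloor_mul {V : Type*} [PseudoEMetricSpace V] (T : ℕ)
    (e : V → ℕ → ℝ) (he : ∀ v v' n, edist (e v n) (e v' n) ≤ edist v v') :
    Continuous fun v => ofPath a b fun s => e v ⌊(T : ℝ) * s⌋₊ := by
  refine LipschitzWith.continuous (K := 1) fun v v' => ?_
  rw [ENNReal.coe_one, one_mul]
  refine (edist_le_iSup _ _).trans (iSup_le fun t => ?_)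
  rw [ofPath_val (isCadlag_comp_natFloor_mul T (e v)),
    ofPath_val (isCadlag_comp_natFloor_mul T (e v'))]
  exact he _ _ _

/-- The step path with random values is a random element of the Skorokhod space. -/
theorem aemeasurable_ofPath_comp_natFloor_mul {Ω : Type*} [MeasurableSpace Ω] {P : Measure Ω}
    (T : ℕ) (g : Ω → ℕ → ℝ) (hg : ∀ n, AEMeasurable (fun ω => g ω n) P) :
    AEMeasurable (fun ω => ofPath a b fun s => g ω ⌊(T : ℝ) * s⌋₊) P := by
  -- `N` exceeds every index `⌊T s⌋₊` with `s ≤ b`. The path is then a 1-Lipschitz image of a random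
  -- vector in `Fin N → ℝ`, which reduces measurability to coordinates.
  obtain ⟨N, hN⟩ : ∃ N, N = ⌊(T : ℝ) * b⌋₊ + 1 := ⟨_, rfl⟩
  let e : (Fin N → ℝ) → ℕ → ℝ := fun v n => if h : n < N then v ⟨n, h⟩ else 0
  have he : ∀ v v' n, edist (e v n) (e v' n) ≤ edist v v' := by
    intro v v' n
    by_cases h : n < N
    · simp only [e, dif_pos h]
      exact edist_le_pi_edist v v' _
    · simp only [e, dif_neg h, edist_self, zero_le]
  have hΦ := (continuous_ofPath_comp_natFloor_mul (a := a) (b := b) T e he).measurable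
  have hg' : AEMeasurable (fun ω (i : Fin N) => g ω i) P :=
    aemeasurable_pi_lambda _ fun i => hg i
  refine (hΦ.comp_aemeasurable hg').congr (Eventually.of_forall fun ω => ?_)
  change ofPath a b (fun s => e (fun i => g ω i) ⌊(T : ℝ) * s⌋₊) = ofPath a b _
  refine ofPath_congr fun t ht => ?_
  have : ⌊(T : ℝ) * t⌋₊ < N := hN ▸
    Nat.lt_succ_of_le (Nat.floor_mono (mul_le_mul_of_nonneg_left ht.2 T.cast_nonneg))
  exact dif_pos this

end SkorokhodSpace

/-! ### An extended continuous mapping theorem -/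

/-- If `X n` converges in distribution to `Z` and `R n` converges to `0` in probability, and if
almost surely `Y n ω` is close to `V` as soon as `n` is large, `X n ω` is close to `Z` and `R n ω`
is close to `0`, then `Y n` converges in distribution to `V`. -/
theorem MeasureTheory.TendstoInDistribution.of_tendsto_comap {Ω Ω' E F : Type*}
    [MeasurableSpace Ω] [MeasurableSpace Ω'] {P : Measure Ω} [IsProbabilityMeasure P]
    {P' : Measure Ω'} [IsProbabilityMeasure P']
    [TopologicalSpace E] [MeasurableSpace E] [OpensMeasurableSpace E] [HasOuterApproxClosed E]
    [TopologicalSpace F] [MeasurableSpace F] [OpensMeasurableSpace F]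
    {X : ℕ → Ω → E} {Z : Ω' → E} {Y : ℕ → Ω → F} {V : Ω' → F} {R : ℕ → Ω → ℝ≥0∞}
    (hX : TendstoInDistribution X atTop Z (fun _ => P) P')
    (hY : ∀ n, AEMeasurable (Y n) P) (hV : AEMeasurable V P')
    (hR : ∀ δ > 0, Tendsto (fun n => P {ω | δ ≤ R n ω}) atTop (𝓝 0))
    (h : ∀ᵐ ω' ∂P', Tendsto (fun p : ℕ × Ω => Y p.1 p.2)
      (comap Prod.fst atTop ⊓ comap (fun p => X p.1 p.2) (𝓝 (Z ω')) ⊓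
        comap (fun p => R p.1 p.2) (𝓝 0)) (𝓝 (V ω'))) :
    TendstoInDistribution Y atTop V (fun _ => P) P' := by
  refine ⟨hY, hV, tendsto_of_forall_isOpen_le_liminf' fun G hG => ?_⟩
  simp only [ProbabilityMeasure.coe_mk]
  simp_rw [Measure.map_apply_of_aemeasurable hV hG.measurableSet,
    Measure.map_apply_of_aemeasurable (hY _) hG.measurableSet]
  let δ : ℕ → ℝ≥0∞ := fun m => (m + 1 : ℝ≥0∞)⁻¹
  have hδ : Antitone δ := fun m n hmn => ENNReal.inv_le_inv.2 (by gcongr)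
  -- Points not attained by any `X n` with `n ≥ m` lie in `A m` vacuously. `A m` need not be
  -- measurable; its interior is open, which is what the portmanteau inequality requires.
  let A : ℕ → Set E := fun m => {x | ∀ n ≥ m, ∀ ω, X n ω = x → R n ω < δ m → Y n ω ∈ G}
  let U : ℕ → Set E := fun m => interior (A m)
  have hU : Monotone U := fun m m' hm => interior_mono fun x hx n hn ω h1 h2 =>
    hx n (hm.trans hn) ω h1 (h2.trans_le (hδ hm))
  have hUo : ∀ m, IsOpen (U m) := fun m => isOpen_interior
  have hsub : P' (V ⁻¹' G) ≤ P' (⋃ m, Z ⁻¹' U m) := by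
    refine measure_mono_ae ?_
    filter_upwards [h] with ω' hω' (hG' : V ω' ∈ G)
    have hev := hω'.eventually (hG.mem_nhds hG')
    obtain ⟨s, hs, t, ht, hst⟩ := Filter.mem_inf_iff_superset.1 hev
    obtain ⟨s₁, hs₁, s₂, hs₂, hs₁₂⟩ := Filter.mem_inf_iff_superset.1 hs
    obtain ⟨a, ha, ha'⟩ := mem_comap.1 hs₁
    obtain ⟨b, hb, hb'⟩ := mem_comap.1 hs₂
    obtain ⟨c, hc, hc'⟩ := mem_comap.1 ht
    obtain ⟨N, hN⟩ := mem_atTop_sets.1 ha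
    obtain ⟨r, hr, hrc⟩ := ENNReal.nhds_zero_basis.mem_iff.1 hc
    obtain ⟨M, hM⟩ := ENNReal.exists_inv_nat_lt hr.ne'
    refine mem_iUnion.2 ⟨max N M, mem_interior_iff_mem_nhds.2 (mem_of_superset hb ?_)⟩
    intro x hx n hn ω hXx hRω
    refine hst (show (n, ω) ∈ s ∩ t from ⟨hs₁₂ ⟨ha' ?_, hb' ?_⟩, hc' ?_⟩)
    · exact hN n ((le_max_left _ _).trans hn)
    · simpa [hXx] using hx
    · refine hrc (lt_trans (hRω.trans_le ?_) hM)
      refine ENNReal.inv_le_inv.2 ?_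
      have : (M : ℝ≥0∞) ≤ (max N M : ℕ) := by exact_mod_cast le_max_right _ _
      exact this.trans le_self_add
  refine hsub.trans ?_
  have hmono : Monotone fun m => Z ⁻¹' U m := fun m m' hm => preimage_mono (hU hm)
  rw [hmono.measure_iUnion]
  refine iSup_le fun m => ?_
  have h1 : P' (Z ⁻¹' U m) ≤ liminf (fun n => P (X n ⁻¹' U m)) atTop := by
    have := ProbabilityMeasure.le_liminf_measure_open_of_tendsto hX.tendsto (hUo m)
    simp only [ProbabilityMeasure.coe_mk] at this
    simp_rw [Measure.map_apply_of_aemeasurable hX.aemeasurable_limit (hUo m).measurableSet,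
      Measure.map_apply_of_aemeasurable (hX.forall_aemeasurable _) (hUo m).measurableSet] at this
    exact this
  have hδm : 0 < δ m := ENNReal.inv_pos.2 (by simp [ENNReal.add_eq_top])
  have h2 : liminf (fun n => P (X n ⁻¹' U m)) atTop ≤
      liminf (fun n => P (Y n ⁻¹' G) + P {ω | δ m ≤ R n ω}) atTop := by
    refine liminf_le_liminf ?_
    filter_upwards [eventually_ge_atTop m] with n hn
    refine (measure_mono fun ω hω => ?_).trans (measure_union_le _ _)
    by_cases hRω : R n ω < δ m
    · exact Or.inl (interior_subset (s := A m) hω n hn ω rfl hRω)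
    · exact Or.inr (not_lt.1 hRω)
  refine h1.trans (h2.trans ?_)
  refine ENNReal.le_of_forall_pos_le_add fun e he _ => ?_
  have h3 : ∀ᶠ n in atTop, P {ω | δ m ≤ R n ω} ≤ e :=
    (hR _ hδm).eventually_le_const (by exact_mod_cast he)
  calc liminf (fun n => P (Y n ⁻¹' G) + P {ω | δ m ≤ R n ω}) atTop
      ≤ liminf (fun n => P (Y n ⁻¹' G) + e) atTop := by
        refine liminf_le_liminf ?_
        filter_upwards [h3] with n hn
        gcongr
    _ ≤ liminf (fun n => P (Y n ⁻¹' G)) atTop + e := by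
        refine (liminf_add_const atTop _ _ ?_ ?_).le
        · isBoundedDefault
        · isBoundedDefault

/-! ### Step functions and integrals with a varying end point -/

/-- Dominated convergence on the fixed interval `[0, 1]`: the indicators of `{x ≤ u i}` converge to
that of `{x ≤ s}` except at the null point `r = s`. -/
theorem tendsto_intervalIntegral_of_tendsto_right {ι : Type*} {l : Filter ι}
    [l.IsCountablyGenerated] {u : ι → ℝ} {s C : ℝ} {f : ι → ℝ → ℝ} {g : ℝ → ℝ}
    (hu : Tendsto u l (𝓝 s)) (hu01 : ∀ᶠ i in l, u i ∈ Icc (0 : ℝ) 1) (hs : s ∈ Icc (0 : ℝ) 1)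
    (hmeas : ∀ᶠ i in l, Measurable (f i)) (hbd : ∀ᶠ i in l, ∀ r ∈ Icc (0 : ℝ) 1, |f i r| ≤ C)
    (hlim : ∀ r ∈ Icc (0 : ℝ) 1, Tendsto (fun i => f i r) l (𝓝 (g r))) :
    Tendsto (fun i => ∫ r in (0 : ℝ)..u i, f i r) l (𝓝 (∫ r in (0 : ℝ)..s, g r)) := by
  rw [← intervalIntegral.integral_indicator hs]
  have h : Tendsto (fun i => ∫ r in (0 : ℝ)..1, indicator {x | x ≤ u i} (f i) r) l
      (𝓝 (∫ r in (0 : ℝ)..1, indicator {x | x ≤ s} g r)) := by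
    refine intervalIntegral.tendsto_integral_filter_of_dominated_convergence (fun _ => |C|)
      ?_ ?_ intervalIntegrable_const ?_
    · filter_upwards [hmeas] with i hi
      exact (hi.indicator measurableSet_Iic).aestronglyMeasurable
    · filter_upwards [hbd] with i hi
      refine Eventually.of_forall fun r hr => ?_
      rw [uIoc_of_le zero_le_one] at hr
      exact (norm_indicator_le_norm_self _ _).trans ((hi r ⟨hr.1.le, hr.2⟩).trans (le_abs_self C))
    · filter_upwards [compl_mem_ae_iff.2 (measure_singleton s)] with r hrs hr
      rw [uIoc_of_le zero_le_one] at hr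
      rcases lt_or_gt_of_ne (show r ≠ s from hrs) with hlt | hlt
      · rw [indicator_of_mem (show r ∈ {x | x ≤ s} from hlt.le)]
        refine (hlim r ⟨hr.1.le, hr.2⟩).congr' ?_
        filter_upwards [hu.eventually_const_lt hlt] with i hi
        exact (indicator_of_mem (show r ∈ {x | x ≤ u i} from le_of_lt hi) _).symm
      · rw [indicator_of_notMem (show r ∉ {x | x ≤ s} from not_le.2 hlt)]
        refine tendsto_nhds_of_eventually_eq ?_
        filter_upwards [hu.eventually_lt_const hlt] with i hi
        exact indicator_of_notMem (show r ∉ {x | x ≤ u i} from not_le.2 hi) _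
  refine h.congr' ?_
  filter_upwards [hu01] with i hi
  exact intervalIntegral.integral_indicator hi

theorem integral_comp_natFloor_mul {T : ℕ} (hT : 0 < T) (v : ℕ → ℝ) {k : ℝ → ℝ}
    (hk : Continuous k) (n : ℕ) :
    ∫ r in (0 : ℝ)..(n / T : ℝ), v ⌊(T : ℝ) * r⌋₊ * k r =
      ∑ t ∈ Finset.range n, v t * ∫ r in (t / T : ℝ)..((t + 1 : ℕ) / T : ℝ), k r := by
  have hT' : (0 : ℝ) < T := by exact_mod_cast hT
  have hfl : ∀ t : ℕ, ∀ r ∈ Ioo (t / T : ℝ) ((t + 1 : ℕ) / T : ℝ), ⌊(T : ℝ) * r⌋₊ = t := by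
    intro t r hr
    have h1 := (div_lt_iff₀ hT').1 hr.1
    have h2 := (lt_div_iff₀ hT').1 hr.2
    rw [Nat.floor_eq_iff (by nlinarith [(Nat.cast_nonneg t : (0 : ℝ) ≤ t)])]
    push_cast at h2
    constructor <;> nlinarith
  have hle : ∀ t : ℕ, (t / T : ℝ) ≤ ((t + 1 : ℕ) / T : ℝ) := fun t => by
    gcongr
    exact Nat.le_succ t
  have heq : ∀ t : ℕ, EqOn (fun r => v t * k r) (fun r => v ⌊(T : ℝ) * r⌋₊ * k r)
      (Ioo (t / T : ℝ) ((t + 1 : ℕ) / T : ℝ)) := fun t r hr => by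
    simp only [hfl t r hr]
  have hint : ∀ t < n, IntervalIntegrable (fun r => v ⌊(T : ℝ) * r⌋₊ * k r) volume
      (t / T : ℝ) ((t + 1 : ℕ) / T : ℝ) := fun t _ => by
    have h1 : IntervalIntegrable (fun r => v t * k r) volume (t / T : ℝ) ((t + 1 : ℕ) / T : ℝ) :=
      (hk.const_mul _).intervalIntegrable _ _
    rw [intervalIntegrable_iff_integrableOn_Ioo_of_le (hle t)] at h1 ⊢
    exact h1.congr_fun (heq t) measurableSet_Ioo
  have := intervalIntegral.sum_integral_adjacent_intervals (a := fun t : ℕ => (t / T : ℝ)) hint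
  simp only [CharP.cast_eq_zero, zero_div] at this
  rw [← this]
  refine Finset.sum_congr rfl fun t _ => ?_
  rw [← intervalIntegral.integral_const_mul, intervalIntegral.integral_of_le (hle t),
    intervalIntegral.integral_of_le (hle t), integral_Ioc_eq_integral_Ioo,
    integral_Ioc_eq_integral_Ioo]
  exact (setIntegral_congr_fun measurableSet_Ioo (heq t)).symm

theorem tendsto_natFloor_mul_div {ι : Type*} {l : Filter ι} {T : ι → ℕ} {s' : ι → ℝ} {s : ℝ}
    (hT : Tendsto T l atTop) (hs' : Tendsto s' l (𝓝 s)) (h0 : ∀ᶠ i in l, 0 ≤ s' i) :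
    Tendsto (fun i => (⌊(T i : ℝ) * s' i⌋₊ : ℝ) / T i) l (𝓝 s) := by
  have hT' : Tendsto (fun i => ((T i : ℝ))⁻¹) l (𝓝 0) :=
    tendsto_inv_atTop_zero.comp (tendsto_natCast_atTop_atTop.comp hT)
  have hlow : Tendsto (fun i => s' i - (T i : ℝ)⁻¹) l (𝓝 s) := by
    simpa using hs'.sub hT'
  refine tendsto_of_tendsto_of_tendsto_of_le_of_le' hlow hs' ?_ ?_
  · filter_upwards [hT.eventually_gt_atTop 0] with i hi
    have hi' : (0 : ℝ) < T i := by exact_mod_cast hi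
    rw [le_div_iff₀ hi', sub_mul, inv_mul_cancel₀ hi'.ne', mul_comm]
    exact (Nat.sub_one_lt_floor _).le
  · filter_upwards [hT.eventually_gt_atTop 0, h0] with i hi h0
    have hi' : (0 : ℝ) < T i := by exact_mod_cast hi
    rw [div_le_iff₀ hi', mul_comm]
    exact Nat.floor_le (by positivity)

theorem TendstoUniformlyOn.tendsto_prod_nhdsWithin {ι α β : Type*} [TopologicalSpace α]
    [UniformSpace β] {F : ι → α → β} {f : α → β} {l : Filter ι} {s : Set α}
    (h : TendstoUniformlyOn F f l s) {x : α} (hx : x ∈ s) (hf : ContinuousWithinAt f s x) :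
    Tendsto (fun p : ι × α => F p.1 p.2) (l ×ˢ 𝓝[s] x) (𝓝 (f x)) :=
  (hf.tendsto.comp tendsto_snd).congr_uniformity
    (tendstoLocallyUniformlyOn_iff_forall_tendsto.1 h.tendstoLocallyUniformlyOn x hx)

/-- On a compact set, with a continuous limit, uniform convergence amounts to continuous convergence
(`F i` evaluated at a moving point). This and the previous lemma reduce uniform claims to limits at
one point along a product filter. -/
theorem tendstoUniformlyOn_of_tendsto_prod_nhdsWithin {ι α β : Type*} [TopologicalSpace α]
    [UniformSpace β] {F : ι → α → β} {f : α → β} {l : Filter ι} {s : Set α} (hs : IsCompact s)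
    (hf : ContinuousOn f s)
    (h : ∀ x ∈ s, Tendsto (fun p : ι × α => F p.1 p.2) (l ×ˢ 𝓝[s] x) (𝓝 (f x))) :
    TendstoUniformlyOn F f l s := by
  refine (tendstoLocallyUniformlyOn_iff_tendstoUniformlyOn_of_compact hs).1
    (tendstoLocallyUniformlyOn_iff_forall_tendsto.2 fun x hx => ?_)
  have h1 : Tendsto (fun p : ι × α => f p.2) (l ×ˢ 𝓝[s] x) (𝓝 (f x)) :=
    (hf x hx).tendsto.comp tendsto_snd
  exact (h1.prodMk_nhds (h x hx)).mono_right (nhds_le_uniformity _)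

/-! ### Convergence of the discretised ratio for deterministic paths -/

/-- The kernel-weighted ratio of the sequences `q` and `w` on the grid of mesh `1 / T`. -/
noncomputable def stepRatio (K : ℝ → ℝ) (lam : ℝ) (T : ℕ) (w q : ℕ → ℝ) (n : ℕ) : ℝ :=
  (n / T : ℝ) / 2 * (q n * K 0 + ∑ t ∈ Finset.range n,
      q t * (K (lam * (n / T - t / T)) - K (lam * (n / T - (t + 1 : ℕ) / T)))) /
    ((T : ℝ)⁻¹ * ∑ t ∈ Finset.range n, w t ^ 2)

/-- The kernel-weighted ratio of the paths `q` and `w`. -/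
noncomputable def pathRatio (K : ℝ → ℝ) (lam : ℝ) (w q : ℝ → ℝ) (s : ℝ) : ℝ :=
  s / 2 * (q s * K 0 + ∫ r in (0 : ℝ)..s, q r * (lam * deriv K (lam * (s - r)))) /
    ∫ r in (0 : ℝ)..s, w r ^ 2

/-- By the fundamental theorem of calculus each kernel difference is the integral of `lam * K'` over
one grid cell, on which the step path is constant. Hence no Riemann-sum error arises. -/
theorem stepRatio_eq {K : ℝ → ℝ} (hK : ContDiff ℝ 1 K) (lam : ℝ) {T : ℕ} (hT : 0 < T)
    (w q : ℕ → ℝ) (n : ℕ) :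
    stepRatio K lam T w q n = (n / T : ℝ) / 2 * (q n * K 0 + ∫ r in (0 : ℝ)..(n / T : ℝ),
        q ⌊(T : ℝ) * r⌋₊ * (lam * deriv K (lam * (n / T - r)))) /
      ∫ r in (0 : ℝ)..(n / T : ℝ), w ⌊(T : ℝ) * r⌋₊ ^ 2 := by
  have hT' : (T : ℝ) ≠ 0 := by exact_mod_cast hT.ne'
  have hd : Continuous (deriv K) := hK.continuous_deriv le_rfl
  have h1 := integral_comp_natFloor_mul hT q
    (k := fun r => lam * deriv K (lam * (n / T - r))) (by fun_prop) n
  have h2 := integral_comp_natFloor_mul hT (fun t => w t ^ 2) (k := fun _ => 1)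
    continuous_const n
  simp only [mul_one] at h2
  rw [stepRatio, h1, h2, Finset.mul_sum]
  congr 1
  · congr 2
    refine Finset.sum_congr rfl fun t _ => ?_
    congr 1
    have : ∀ r ∈ uIcc (t / T : ℝ) ((t + 1 : ℕ) / T : ℝ),
        HasDerivAt (fun r : ℝ => - K (lam * (n / T - r)))
          (lam * deriv K (lam * (n / T - r))) r := fun r _ => by
      have hK' := (hK.differentiable one_ne_zero (lam * (n / T - r))).hasDerivAt
      have hin : HasDerivAt (fun r : ℝ => lam * (n / T - r)) (lam * -1) r :=
        ((hasDerivAt_id r).const_sub _).const_mul lam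
      exact (hK'.comp r hin).neg.congr_deriv (by ring)
    rw [intervalIntegral.integral_eq_sub_of_hasDerivAt this
      (Continuous.intervalIntegrable (by fun_prop) _ _)]
    ring
  · refine Finset.sum_congr rfl fun t _ => ?_
    rw [intervalIntegral.integral_const, smul_eq_mul, mul_one, mul_comm]
    congr 1
    push_cast
    field_simp
    ring

theorem continuousOn_pathRatio {K : ℝ → ℝ} (hK : ContDiff ℝ 1 K) (lam : ℝ) {w q : ℝ → ℝ}
    (hw : Continuous w) (hq : Continuous q) {S : Set ℝ}
    (hpos : ∀ s ∈ S, ∫ r in (0 : ℝ)..s, w r ^ 2 ≠ 0) :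
    ContinuousOn (pathRatio K lam w q) S := by
  have hd : Continuous (deriv K) := hK.continuous_deriv le_rfl
  have h1 : Continuous fun s => ∫ r in (0 : ℝ)..s, q r * (lam * deriv K (lam * (s - r))) :=
    intervalIntegral.continuous_parametric_intervalIntegral_of_continuous
      (f := fun s r => q r * (lam * deriv K (lam * (s - r)))) (by fun_prop) continuous_id
  have h2 : Continuous fun s => ∫ r in (0 : ℝ)..s, w r ^ 2 :=
    intervalIntegral.continuous_parametric_intervalIntegral_of_continuous
      (f := fun _ r => w r ^ 2) (by fun_prop) continuous_id
  exact ContinuousOn.div (by fun_prop) h2.continuousOn hpos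

/-- By continuous convergence it suffices to fix `s` and let the end point `⌊T s'⌋ / T` tend to `s`.
Dominated convergence then handles the two integrals. The general filter `l` is needed for the later
use on `ℕ × Ω`. -/
theorem tendstoUniformlyOn_stepRatio {ι : Type*} {l : Filter ι} [l.IsCountablyGenerated]
    {K : ℝ → ℝ} (hK : ContDiff ℝ 1 K) {C : ℝ} (hC : ∀ z, |deriv K z| ≤ C)
    {κ lam : ℝ} (hκ : 0 ≤ κ) {w q : ℝ → ℝ} (hw : Continuous w) (hq : Continuous q)
    (hpos : ∀ s ∈ Icc κ 1, ∫ r in (0 : ℝ)..s, w r ^ 2 ≠ 0)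
    {T : ι → ℕ} (hT : Tendsto T l atTop) {lams : ι → ℝ} (hlam : Tendsto lams l (𝓝 lam))
    {ws qs : ι → ℕ → ℝ}
    (hws : TendstoUniformlyOn (fun i r => ws i ⌊(T i : ℝ) * r⌋₊) w l (Icc 0 1))
    (hqs : TendstoUniformlyOn (fun i r => qs i ⌊(T i : ℝ) * r⌋₊) q l (Icc 0 1)) :
    TendstoUniformlyOn (fun i s => stepRatio K (lams i) (T i) (ws i) (qs i) ⌊(T i : ℝ) * s⌋₊)
      (pathRatio K lam w q) l (Icc κ 1) := by
  have hd : Continuous (deriv K) := hK.continuous_deriv le_rfl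
  refine tendstoUniformlyOn_of_tendsto_prod_nhdsWithin isCompact_Icc
    (continuousOn_pathRatio hK lam hw hq hpos) fun s hs => ?_
  have hsub : Icc κ 1 ⊆ Icc (0 : ℝ) 1 := Icc_subset_Icc_left hκ
  have hs01 := hsub hs
  have hT₁ : Tendsto (fun p : ι × ℝ => T p.1) (l ×ˢ 𝓝[Icc κ 1] s) atTop := hT.comp tendsto_fst
  have hlam₁ : Tendsto (fun p : ι × ℝ => lams p.1) (l ×ˢ 𝓝[Icc κ 1] s) (𝓝 lam) :=
    hlam.comp tendsto_fst
  have hmem : ∀ᶠ p : ι × ℝ in l ×ˢ 𝓝[Icc κ 1] s, p.2 ∈ Icc κ 1 :=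
    tendsto_snd.eventually self_mem_nhdsWithin
  have hTpos : ∀ᶠ p : ι × ℝ in l ×ˢ 𝓝[Icc κ 1] s, 0 < T p.1 := hT₁.eventually_gt_atTop 0
  have hu : Tendsto (fun p : ι × ℝ => (⌊(T p.1 : ℝ) * p.2⌋₊ : ℝ) / T p.1)
      (l ×ˢ 𝓝[Icc κ 1] s) (𝓝 s) :=
    tendsto_natFloor_mul_div hT₁ (tendsto_snd.mono_right nhdsWithin_le_nhds)
      (hmem.mono fun p hp => (hsub hp).1)
  have hu01 : ∀ᶠ p : ι × ℝ in l ×ˢ 𝓝[Icc κ 1] s,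
      (⌊(T p.1 : ℝ) * p.2⌋₊ : ℝ) / T p.1 ∈ Icc (0 : ℝ) 1 := by
    filter_upwards [hmem, hTpos] with p hp hTp
    have hTp' : (0 : ℝ) < T p.1 := by exact_mod_cast hTp
    refine ⟨by positivity, (div_le_one hTp').2 ?_⟩
    have h0 := (hsub hp).1
    exact (Nat.floor_le (by positivity)).trans (mul_le_of_le_one_right hTp'.le hp.2)
  have key : ∀ {v : ℝ → ℝ} {vs : ι → ℕ → ℝ}, Continuous v →
      TendstoUniformlyOn (fun i r => vs i ⌊(T i : ℝ) * r⌋₊) v l (Icc 0 1) →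
      (∃ M, 0 ≤ M ∧ ∀ᶠ p : ι × ℝ in l ×ˢ 𝓝[Icc κ 1] s, ∀ r ∈ Icc (0 : ℝ) 1,
        |vs p.1 ⌊(T p.1 : ℝ) * r⌋₊| ≤ M) ∧
      (∀ r ∈ Icc (0 : ℝ) 1, Tendsto (fun p : ι × ℝ => vs p.1 ⌊(T p.1 : ℝ) * r⌋₊)
        (l ×ˢ 𝓝[Icc κ 1] s) (𝓝 (v r))) ∧
      (∀ i, Measurable fun r : ℝ => vs i ⌊(T i : ℝ) * r⌋₊) := by
    intro v vs hv hvs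
    refine ⟨?_, fun r hr => (hvs.tendsto_at hr).comp tendsto_fst, fun i =>
      (measurable_from_nat (f := vs i)).comp (Nat.measurable_floor.comp (measurable_const_mul _))⟩
    obtain ⟨M, hM⟩ := isCompact_Icc.exists_bound_of_continuousOn (s := Icc (0 : ℝ) 1)
      hv.continuousOn
    refine ⟨|M| + 1, by positivity, ?_⟩
    have := tendsto_fst (f := l) (g := 𝓝[Icc κ 1] s) |>.eventually
      (Metric.tendstoUniformlyOn_iff.1 hvs 1 one_pos)
    filter_upwards [this] with p hp r hr
    have h1 := hp r hr
    have h2 := hM r hr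
    rw [dist_comm, Real.dist_eq] at h1
    rw [Real.norm_eq_abs] at h2
    have h3 := abs_sub_abs_le_abs_sub (vs p.1 ⌊(T p.1 : ℝ) * r⌋₊) (v r)
    linarith [le_abs_self M]
  obtain ⟨⟨Mq, hMq0, hMq⟩, hqlim, hqmeas⟩ := key hq hqs
  obtain ⟨⟨Mw, hMw0, hMw⟩, hwlim, hwmeas⟩ := key hw hws
  have hnum : Tendsto (fun p : ι × ℝ => ∫ r in (0 : ℝ)..(⌊(T p.1 : ℝ) * p.2⌋₊ : ℝ) / T p.1,
      qs p.1 ⌊(T p.1 : ℝ) * r⌋₊ *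
        (lams p.1 * deriv K (lams p.1 * ((⌊(T p.1 : ℝ) * p.2⌋₊ : ℝ) / T p.1 - r))))
      (l ×ˢ 𝓝[Icc κ 1] s) (𝓝 (∫ r in (0 : ℝ)..s, q r * (lam * deriv K (lam * (s - r))))) := by
    -- Here `|lam| + 1` eventually bounds `|lams i|`, and `C` bounds `K'`.
    refine tendsto_intervalIntegral_of_tendsto_right (C := Mq * ((|lam| + 1) * C)) hu hu01 hs01
      (Eventually.of_forall fun p => (hqmeas p.1).mul (by fun_prop)) ?_ fun r hr => ?_
    · filter_upwards [hMq, hlam₁.abs.eventually_le_const (lt_add_one _)] with p h1 h2 r hr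
      rw [abs_mul, abs_mul]
      gcongr
      · exact h1 r hr
      · exact hC _
    · exact (hqlim r hr).mul (hlam₁.mul ((hd.tendsto _).comp (hlam₁.mul (hu.sub_const r))))
  have hden : Tendsto (fun p : ι × ℝ => ∫ r in (0 : ℝ)..(⌊(T p.1 : ℝ) * p.2⌋₊ : ℝ) / T p.1,
      ws p.1 ⌊(T p.1 : ℝ) * r⌋₊ ^ 2)
      (l ×ˢ 𝓝[Icc κ 1] s) (𝓝 (∫ r in (0 : ℝ)..s, w r ^ 2)) := by
    refine tendsto_intervalIntegral_of_tendsto_right (C := Mw ^ 2) hu hu01 hs01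
      (Eventually.of_forall fun p => (hwmeas p.1).pow_const 2) ?_ fun r hr => (hwlim r hr).pow 2
    filter_upwards [hMw] with p h1 r hr
    rw [abs_pow]
    gcongr
    exact h1 r hr
  have hqs' : Tendsto (fun p : ι × ℝ => qs p.1 ⌊(T p.1 : ℝ) * p.2⌋₊) (l ×ˢ 𝓝[Icc κ 1] s)
      (𝓝 (q s)) :=
    (hqs.mono hsub).tendsto_prod_nhdsWithin hs hq.continuousWithinAt
  have := ((hu.div_const 2).mul ((hqs'.mul_const (K 0)).add hnum)).div hden (hpos s hs)
  refine this.congr' ?_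
  filter_upwards [hTpos] with p hp
  exact (stepRatio_eq hK _ hp _ _ _).symm

/-! ### Probabilistic ingredients -/

/-- A sequence that converges in distribution is bounded in probability. -/
theorem MeasureTheory.TendstoInDistribution.tendsto_measure_le_edist {Ω Ω' E : Type*}
    [MeasurableSpace Ω] [MeasurableSpace Ω'] {P : Measure Ω} [IsProbabilityMeasure P]
    {P' : Measure Ω'} [IsProbabilityMeasure P']
    [PseudoEMetricSpace E] [MeasurableSpace E] [OpensMeasurableSpace E]
    {X : ℕ → Ω → E} {Z : Ω' → E} (hX : TendstoInDistribution X atTop Z (fun _ => P) P')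
    (c : E) (hZ : ∀ᵐ ω ∂P', edist (Z ω) c ≠ ⊤) {a : ℕ → ℝ≥0∞} (ha : Tendsto a atTop (𝓝 ⊤)) :
    Tendsto (fun n => P {ω | a n ≤ edist (X n ω) c}) atTop (𝓝 0) := by
  let F : ℕ → Set E := fun M => {x | (M : ℝ≥0∞) ≤ edist x c}
  have hF : ∀ M, IsClosed (F M) := fun M => isClosed_le continuous_const (by fun_prop)
  have hanti : Antitone fun M => Z ⁻¹' F M := fun M M' h ω hω =>
    le_trans (show (M : ℝ≥0∞) ≤ M' by exact_mod_cast h) (show (M' : ℝ≥0∞) ≤ edist (Z ω) c from hω)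
  have hlim : Tendsto (fun M => P' (Z ⁻¹' F M)) atTop (𝓝 0) := by
    have h1 := tendsto_measure_iInter_atTop (μ := P') (s := fun M => Z ⁻¹' F M)
      (fun M => hX.aemeasurable_limit.nullMeasurable (hF M).measurableSet) hanti
      ⟨0, measure_ne_top _ _⟩
    have h2 : P' (⋂ M, Z ⁻¹' F M) = 0 := by
      refine measure_mono_null (fun ω hω => ?_) hZ
      simp only [mem_iInter, mem_preimage] at hω
      simp only [mem_compl_iff, mem_ofPred_eq, ne_eq, not_not]
      exact ENNReal.eq_top_of_forall_nnreal_le fun r => by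
        obtain ⟨M, hM⟩ := exists_nat_ge r
        exact le_trans (by exact_mod_cast hM) (hω M)
    rwa [h2] at h1
  refine ENNReal.tendsto_nhds_zero.2 fun e he => ?_
  obtain ⟨M, hM⟩ := (hlim.eventually_lt_const he).exists
  have hls := ProbabilityMeasure.limsup_measure_closed_le_of_tendsto hX.tendsto (hF M)
  simp only [ProbabilityMeasure.coe_mk] at hls
  simp_rw [Measure.map_apply_of_aemeasurable hX.aemeasurable_limit (hF M).measurableSet,
    Measure.map_apply_of_aemeasurable (hX.forall_aemeasurable _) (hF M).measurableSet] at hls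
  filter_upwards [eventually_lt_of_limsup_lt (hls.trans_lt hM),
    ha.eventually_const_le (ENNReal.natCast_lt_top M)] with n h1 h2
  exact (measure_mono fun ω hω => le_trans h2 hω).trans h1.le

/-- The event forces the distance to exceed a threshold of order `√n`, which has vanishing
probability by boundedness in probability. -/
theorem tendsto_measure_le_inv_sqrt_mul_edist {Ω Ω' E : Type*}
    [MeasurableSpace Ω] [MeasurableSpace Ω'] {P : Measure Ω} [IsProbabilityMeasure P]
    {P' : Measure Ω'} [IsProbabilityMeasure P']
    [PseudoEMetricSpace E] [MeasurableSpace E] [OpensMeasurableSpace E]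
    {X : ℕ → Ω → E} {Z : Ω' → E} (hX : TendstoInDistribution X atTop Z (fun _ => P) P')
    (c : E) (hZ : ∀ᵐ ω ∂P', edist (Z ω) c ≠ ⊤) {δ : ℝ≥0∞} (hδ : 0 < δ) :
    Tendsto (fun n : ℕ => P {ω | δ ≤ ENNReal.ofReal (√(n : ℝ))⁻¹ * edist (X n ω) c}) atTop
      (𝓝 0) := by
  have h0 : Tendsto (fun n : ℕ => ENNReal.ofReal (√(n : ℝ))⁻¹) atTop (𝓝 0) := by
    rw [← ENNReal.ofReal_zero]
    exact ENNReal.tendsto_ofReal (tendsto_inv_atTop_zero.comp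
      (Real.tendsto_sqrt_atTop.comp tendsto_natCast_atTop_atTop))
  have ha : Tendsto (fun n : ℕ => min δ 1 / ENNReal.ofReal (√(n : ℝ))⁻¹) atTop (𝓝 ⊤) := by
    have := ENNReal.Tendsto.const_div (a := min δ 1) h0 (Or.inl ENNReal.zero_ne_top)
    rwa [ENNReal.div_zero (lt_min hδ one_pos).ne'] at this
  refine tendsto_of_tendsto_of_tendsto_of_le_of_le tendsto_const_nhds
    (hX.tendsto_measure_le_edist c hZ ha) (fun _ => zero_le) fun n => measure_mono fun ω hω => ?_
  refine ENNReal.div_le_of_le_mul' ?_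
  exact (min_le_left _ _).trans hω

/-- At each time `1 / (n + 1)` the law is a nondegenerate Gaussian, so almost surely `B` is nonzero
at all these countably many times. One of them lies below any `s > 0`, and continuity makes the
integral positive for all `s` simultaneously. -/
theorem ProbabilityTheory.IsBrownianReal.ae_integral_sq_pos {Ω : Type*} [MeasurableSpace Ω]
    {P : Measure Ω} {B : ℝ≥0 → Ω → ℝ} (hB : IsBrownianReal B P) :
    ∀ᵐ ω ∂P, ∀ s : ℝ, 0 < s → 0 < ∫ r in (0 : ℝ)..s, B r.toNNReal ω ^ 2 := by
  have hne : ∀ n : ℕ, ∀ᵐ ω ∂P, B (1 / ((n : ℝ≥0) + 1)) ω ≠ 0 := fun n => by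
    have hlaw := hB.hasLaw_eval (1 / ((n : ℝ≥0) + 1))
    have hv : (1 / ((n : ℝ≥0) + 1)) ≠ 0 := by positivity
    have := nullSingletonClass_gaussianReal (μ := 0) hv
    refine ae_of_ae_map hlaw.aemeasurable (p := fun x => x ≠ 0) ?_
    rw [hlaw.map_eq]
    exact compl_mem_ae_iff.2 (measure_singleton 0)
  filter_upwards [hB.cont, ae_all_iff.2 hne] with ω hc hω s hs
  obtain ⟨n, hn⟩ := exists_nat_one_div_lt hs
  refine intervalIntegral.integral_pos hs (Continuous.continuousOn ?_)
    (fun _ _ => sq_nonneg _) ⟨1 / ((n : ℝ) + 1), ⟨by positivity, hn.le⟩, ?_⟩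
  · exact (hc.comp continuous_real_toNNReal).pow 2
  · have : (1 / ((n : ℝ) + 1)).toNNReal = 1 / ((n : ℝ≥0) + 1) := by
      apply NNReal.eq
      rw [Real.coe_toNNReal _ (by positivity)]
      push_cast
      rfl
    rw [this]
    exact pow_pos (abs_pos.2 (hω n)) 2 |>.trans_eq (sq_abs _)

/-! ### The weighted Dickey-Fuller process as a discretised ratio -/

theorem Finset.sum_Icc_one_eq_sum_range {M : Type*} [AddCommMonoid M] (f : ℕ → M) (n : ℕ) :
    ∑ t ∈ Finset.Icc 1 n, f t = ∑ t ∈ Finset.range n, f (t + 1) := by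
  induction n with
  | zero => simp
  | succ n ih => rw [Finset.sum_Icc_succ_top (by omega), ih, Finset.sum_range_succ]

theorem IsAR1.eq_sum {Ω : Type*} {Y ε : ℕ → Ω → ℝ} (hY : IsAR1 1 Y ε) (n : ℕ) (ω : Ω) :
    Y n ω = ∑ i ∈ Finset.Icc 1 n, ε i ω := by
  induction n with
  | zero => simp [hY.zero]
  | succ n ih => rw [Finset.sum_Icc_succ_top (by omega), ← ih, hY.step _ (by omega), one_mul,
      Nat.add_sub_cancel]

/-- The compensated squared random walk `T⁻¹ (Y_n² - ∑_{i ≤ n} ε_i²)`. -/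
noncomputable def compensatedSquare {Ω : Type*} (Y ε : ℕ → Ω → ℝ) (T : ℕ) (ω : Ω) (n : ℕ) : ℝ :=
  (T : ℝ)⁻¹ * (Y n ω ^ 2 - ∑ i ∈ Finset.Icc 1 n, ε i ω ^ 2)

theorem dickeyFullerProcess_eq_stepRatio {Ω : Type*} {Y ε : ℕ → Ω → ℝ} (hY : IsAR1 1 Y ε)
    (K : ℝ → ℝ) {h : ℝ} (hh : 0 < h) {T : ℕ} (hT : 0 < T) (ω : Ω) (s : ℝ) :
    dickeyFullerProcess K h Y T ω s =
      stepRatio K (T / h) T (fun n => (√(T : ℝ))⁻¹ * ∑ i ∈ Finset.Icc 1 n, ε i ω)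
        (compensatedSquare Y ε T ω) ⌊(T : ℝ) * s⌋₊ := by
  have hT' : (0 : ℝ) < T := by exact_mod_cast hT
  simp only [dickeyFullerProcess, stepRatio, ← hY.eq_sum]
  generalize ⌊(T : ℝ) * s⌋₊ = n
  rcases Nat.eq_zero_or_pos n with rfl | hn
  · simp
  have hn' : (0 : ℝ) < n := by exact_mod_cast hn
  have hden : (T : ℝ)⁻¹ * ∑ t ∈ Finset.range n, ((√(T : ℝ))⁻¹ * Y t ω) ^ 2 =
      ((T : ℝ) ^ 2)⁻¹ * ∑ t ∈ Finset.Icc 1 n, Y (t - 1) ω ^ 2 := by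
    rw [Finset.sum_Icc_one_eq_sum_range, Finset.mul_sum, Finset.mul_sum]
    refine Finset.sum_congr rfl fun t _ => ?_
    rw [mul_pow, inv_pow, Real.sq_sqrt hT'.le, Nat.add_sub_cancel]
    field_simp
  have hnum : compensatedSquare Y ε T ω n * K 0 + ∑ t ∈ Finset.range n,
      compensatedSquare Y ε T ω t * (K ((T : ℝ) / h * (n / T - t / T)) -
        K ((T : ℝ) / h * (n / T - (t + 1 : ℕ) / T))) =
      2 * (T : ℝ)⁻¹ * ∑ t ∈ Finset.Icc 1 n,
        Y (t - 1) ω * (Y t ω - Y (t - 1) ω) * K (((n : ℝ) - (t : ℝ)) / h) := by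
    have hK : ∀ t : ℕ, K ((T : ℝ) / h * (n / T - t / T)) = K (((n : ℝ) - (t : ℝ)) / h) :=
      fun t => by
        congr 1
        field_simp
    -- Summation by parts: the boundary term at `0` vanishes because `Y 0 = 0`, and the one at `n`
    -- carries the factor `K 0`.
    have htel := Finset.sum_range_sub
      (fun t => compensatedSquare Y ε T ω t * K (((n : ℝ) - (t : ℝ)) / h)) n
    have h0 : compensatedSquare Y ε T ω 0 = 0 := by simp [compensatedSquare, hY.zero]
    simp only [h0, sub_self, zero_div, zero_mul, sub_zero] at htel
    rw [← htel, ← Finset.sum_add_distrib, Finset.sum_Icc_one_eq_sum_range, Finset.mul_sum]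
    refine Finset.sum_congr rfl fun t _ => ?_
    rw [hK, hK]
    have hstep : compensatedSquare Y ε T ω (t + 1) - compensatedSquare Y ε T ω t =
        2 * (T : ℝ)⁻¹ * (Y t ω * (Y (t + 1) ω - Y t ω)) := by
      have h1 := hY.step (t + 1) (by omega) ω
      rw [Nat.add_sub_cancel, one_mul] at h1
      rw [compensatedSquare, compensatedSquare, Finset.sum_Icc_succ_top (by omega), h1]
      ring
    rw [Nat.add_sub_cancel]
    linear_combination K (((n : ℝ) - ((t + 1 : ℕ) : ℝ)) / h) * hstep
  rw [hnum, hden]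
  -- If the denominator vanishes, both quotients are `0` by the convention `x / 0 = 0`.
  rcases eq_or_ne (∑ t ∈ Finset.Icc 1 n, Y (t - 1) ω ^ 2) 0 with h0 | h0
  · simp [h0]
  · field_simp

/-! ### The limit process as a ratio of continuous paths -/

/-- Integration by parts; it converts the drift `-v r` of `q` into the integral of `K` in the limit.
-/
theorem mul_add_integral_mul_deriv_eq {K : ℝ → ℝ} (hK : ContDiff ℝ 1 K) (ζ s : ℝ) :
    s * K 0 + ∫ r in (0 : ℝ)..s, r * (ζ * deriv K (ζ * (s - r))) =
      ∫ r in (0 : ℝ)..s, K (ζ * (s - r)) := by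
  have hd : Continuous (deriv K) := hK.continuous_deriv le_rfl
  have hv : ∀ r ∈ uIcc 0 s, HasDerivAt (fun r : ℝ => - K (ζ * (s - r)))
      (ζ * deriv K (ζ * (s - r))) r := fun r _ => by
    have hK' := (hK.differentiable one_ne_zero (ζ * (s - r))).hasDerivAt
    have hin : HasDerivAt (fun r : ℝ => ζ * (s - r)) (ζ * -1) r :=
      ((hasDerivAt_id r).const_sub _).const_mul ζ
    exact (hK'.comp r hin).neg.congr_deriv (by ring)
  have := intervalIntegral.integral_mul_deriv_eq_deriv_mul (u := fun r => r) (u' := fun _ => 1)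
    (fun r _ => hasDerivAt_id r) hv intervalIntegrable_const
    (Continuous.intervalIntegrable (by fun_prop) _ _)
  rw [this]
  simp

/-- Numerator and denominator are divided by `η²`, and `ϑ⁻² = v / η²`. With division by zero read as
`0` this also holds at `v = 0`, so `0 ≤ v` suffices. -/
theorem limitProcess_eq_pathRatio {Ω : Type*} {K : ℝ → ℝ} (hK : ContDiff ℝ 1 K)
    {B : ℝ≥0 → Ω → ℝ} {ω : Ω} (hB : Continuous fun t => B t ω) {η : ℝ} (hη : η ≠ 0) {v : ℝ}
    (hv : 0 ≤ v) (ζ : ℝ) {s : ℝ} (hs : s ≠ 0) :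
    limitProcess K ζ (η / √v) B ω s =
      pathRatio K ζ (scaledPath η B ω) (fun r => scaledPath η B ω r ^ 2 - v * r) s := by
  have hd : Continuous (deriv K) := hK.continuous_deriv le_rfl
  have hBc : Continuous fun r : ℝ => B r.toNNReal ω := hB.comp continuous_real_toNNReal
  rw [limitProcess, if_neg hs, pathRatio, ← mul_add_integral_mul_deriv_eq hK]
  have h1 : ∫ r in (0 : ℝ)..s, scaledPath η B ω r ^ 2 =
      η ^ 2 * ∫ r in (0 : ℝ)..s, B r.toNNReal ω ^ 2 := by
    rw [← intervalIntegral.integral_const_mul]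
    simp only [scaledPath, mul_pow]
  have h2 : ∫ r in (0 : ℝ)..s, (scaledPath η B ω r ^ 2 - v * r) * (ζ * deriv K (ζ * (s - r))) =
      η ^ 2 * (ζ * ∫ r in (0 : ℝ)..s, B r.toNNReal ω ^ 2 * deriv K (ζ * (s - r))) -
      v * ∫ r in (0 : ℝ)..s, r * (ζ * deriv K (ζ * (s - r))) := by
    rw [← intervalIntegral.integral_const_mul, ← intervalIntegral.integral_const_mul,
      ← intervalIntegral.integral_const_mul, ← intervalIntegral.integral_sub
        (Continuous.intervalIntegrable (by fun_prop) _ _)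
        (Continuous.intervalIntegrable (by fun_prop) _ _)]
    refine intervalIntegral.integral_congr fun r _ => ?_
    simp only [scaledPath]
    ring
  rw [h1, h2, div_pow, Real.sq_sqrt hv, scaledPath]
  generalize (∫ r in (0 : ℝ)..s, B r.toNNReal ω ^ 2) = I
  rcases eq_or_ne I 0 with h0 | h0
  · simp [h0]
  · rw [inv_div]
    field_simp
    ring

/-! ### Convergence of the weighted Dickey-Fuller process -/

theorem continuous_scaledPath {Ω : Type*} {B : ℝ≥0 → Ω → ℝ} {ω : Ω}
    (hB : Continuous fun t => B t ω) (c : ℝ) : Continuous (scaledPath c B ω) :=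
  (hB.comp continuous_real_toNNReal).const_mul c

theorem isCadlag_partialSumProcess {Ω : Type*} (ξ : ℕ → Ω → ℝ) (T : ℕ) (ω : Ω) (a b : ℝ) :
    IsCadlag fun t : Icc a b => partialSumProcess ξ T ω t :=
  isCadlag_comp_natFloor_mul T fun n => (√(T : ℝ))⁻¹ * ∑ i ∈ Finset.Icc 1 n, ξ i ω

theorem aemeasurable_stepRatio {Ω : Type*} [MeasurableSpace Ω] {P : Measure Ω} (K : ℝ → ℝ)
    (lam : ℝ) (T : ℕ) {w q : Ω → ℕ → ℝ} (hw : ∀ n, AEMeasurable (fun ω => w ω n) P)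
    (hq : ∀ n, AEMeasurable (fun ω => q ω n) P) (n : ℕ) :
    AEMeasurable (fun ω => stepRatio K lam T (w ω) (q ω) n) P := by
  unfold stepRatio
  refine AEMeasurable.div (AEMeasurable.const_mul (((hq n).mul_const _).add ?_) _)
    (AEMeasurable.const_mul ?_ _)
  · exact Finset.aemeasurable_fun_sum _ fun t _ => (hq t).mul_const _
  · exact Finset.aemeasurable_fun_sum _ fun t _ => (hw t).pow_const 2

/-- The limit is almost surely the limit of `stepRatio` applied to `η B` sampled on the grid `n /
N`. These step paths are measurable, and the deterministic theorem gives the convergence. -/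
theorem aemeasurable_ofPath_limitProcess {Ω : Type*} [MeasurableSpace Ω] {P : Measure Ω}
    {B : ℝ≥0 → Ω → ℝ} (hB : IsBrownianReal B P) {K : ℝ → ℝ} (hK : ContDiff ℝ 1 K) {C : ℝ}
    (hC : ∀ z, |deriv K z| ≤ C) (ζ : ℝ) {η : ℝ} (hη : η ≠ 0) {v : ℝ} (hv : 0 ≤ v) {κ : ℝ}
    (hκ : 0 < κ) :
    AEMeasurable (fun ω => SkorokhodSpace.ofPath κ 1 (limitProcess K ζ (η / √v) B ω)) P := by
  let ws : ℕ → Ω → ℕ → ℝ := fun N ω n => scaledPath η B ω (n / N)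
  let qs : ℕ → Ω → ℕ → ℝ := fun N ω n => scaledPath η B ω (n / N) ^ 2 - v * (n / N)
  have hws : ∀ N n, AEMeasurable (fun ω => ws N ω n) P := fun N n =>
    (hB.aemeasurable _).const_mul η
  have hqs : ∀ N n, AEMeasurable (fun ω => qs N ω n) P := fun N n =>
    ((hws N n).pow_const 2).sub_const _
  refine aemeasurable_of_tendsto_metrizable_ae' (f := fun N ω => SkorokhodSpace.ofPath κ 1
    fun s => stepRatio K ζ N (ws N ω) (qs N ω) ⌊(N : ℝ) * s⌋₊) (fun N =>
    SkorokhodSpace.aemeasurable_ofPath_comp_natFloor_mul N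
      (fun ω => stepRatio K ζ N (ws N ω) (qs N ω))
      (aemeasurable_stepRatio K ζ N (hws N) (hqs N))) ?_
  filter_upwards [hB.cont, hB.ae_integral_sq_pos] with ω hc hpos
  have hw := continuous_scaledPath hc η
  have hq : Continuous fun r => scaledPath η B ω r ^ 2 - v * r := by fun_prop
  have hpos' : ∀ s ∈ Icc κ 1, ∫ r in (0 : ℝ)..s, scaledPath η B ω r ^ 2 ≠ 0 := fun s hs => by
    simp only [scaledPath, mul_pow]
    rw [intervalIntegral.integral_const_mul]
    exact mul_ne_zero (pow_ne_zero 2 hη) (hpos s (hκ.trans_le hs.1)).ne'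
  rw [SkorokhodSpace.ofPath_congr fun t ht =>
    limitProcess_eq_pathRatio hK hc hη hv ζ (hκ.trans_le ht.1).ne']
  refine SkorokhodSpace.tendsto_ofPath
    (Eventually.of_forall fun N => isCadlag_comp_natFloor_mul N _)
    (Continuous.isCadlag (continuousOn_iff_continuous_domRestrict.1
      (continuousOn_pathRatio hK ζ hw hq hpos'))) ?_
  have hfl : ∀ x ∈ Icc (0 : ℝ) 1, Tendsto (fun p : ℕ × ℝ => (⌊(p.1 : ℝ) * p.2⌋₊ : ℝ) / p.1)
      (atTop ×ˢ 𝓝[Icc 0 1] x) (𝓝 x) := fun x _ =>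
    tendsto_natFloor_mul_div tendsto_fst (tendsto_snd.mono_right nhdsWithin_le_nhds)
      (tendsto_snd.eventually (eventually_mem_nhdsWithin.mono fun _ h => h.1))
  exact tendstoUniformlyOn_stepRatio hK hC hκ.le hw hq hpos' tendsto_id tendsto_const_nhds
    (tendstoUniformlyOn_of_tendsto_prod_nhdsWithin isCompact_Icc hw.continuousOn fun x hx =>
      (hw.tendsto x).comp (hfl x hx))
    (tendstoUniformlyOn_of_tendsto_prod_nhdsWithin isCompact_Icc hq.continuousOn fun x hx =>
      (hq.tendsto x).comp (hfl x hx))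

theorem IsStrictlyStationary.integral_sq_eq {Ω : Type*} [MeasurableSpace Ω] {ε : ℕ → Ω → ℝ}
    {P : Measure Ω} (h : IsStrictlyStationary ε P) {t : ℕ} (ht : 1 ≤ t) :
    ∫ ω, ε t ω ^ 2 ∂P = ∫ ω, ε 1 ω ^ 2 ∂P := by
  have := (h 1 (fun _ => 1) (t - 1) fun _ => le_rfl).comp
    (u := fun v : Fin 1 → ℝ => v 0 ^ 2) (by fun_prop)
  have h2 := this.integral_eq
  simp only [Function.comp_def, Nat.add_sub_cancel' ht] at h2
  exact h2.symm

/-- This isolates the remainder with its extra factor `T^{-1/2}`. The means `m t` stay separate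
because each square is centred by its own expectation. -/
theorem partialSum_sq_eq_compensatedSquare {Ω : Type*} {Y ε : ℕ → Ω → ℝ} (hY : IsAR1 1 Y ε)
    {T : ℕ} (hT : 0 < T) (v : ℝ) (ω : Ω) (r : ℝ) {m : ℕ → ℝ} (hm : ∀ t, 1 ≤ t → m t = v) :
    compensatedSquare Y ε T ω ⌊(T : ℝ) * r⌋₊ =
      partialSumProcess ε T ω r ^ 2 -
        (√(T : ℝ))⁻¹ * partialSumProcess (fun t ω => ε t ω ^ 2 - m t) T ω r -
        v * (⌊(T : ℝ) * r⌋₊ / T) := by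
  have hT' : (0 : ℝ) < T := by exact_mod_cast hT
  have hsq : (√(T : ℝ))⁻¹ * (√(T : ℝ))⁻¹ = (T : ℝ)⁻¹ := by
    rw [← mul_inv, Real.mul_self_sqrt hT'.le]
  have hsum : ∑ i ∈ Finset.Icc 1 ⌊(T : ℝ) * r⌋₊, (ε i ω ^ 2 - m i) =
      ∑ i ∈ Finset.Icc 1 ⌊(T : ℝ) * r⌋₊, ε i ω ^ 2 - ⌊(T : ℝ) * r⌋₊ * v := by
    rw [Finset.sum_sub_distrib,
      Finset.sum_congr rfl fun i hi => hm i (Finset.mem_Icc.1 hi).1]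
    simp
  rw [compensatedSquare, partialSumProcess, partialSumProcess, hsum, ← hY.eq_sum, mul_pow,
    sq (√(T : ℝ))⁻¹, ← mul_assoc, hsq]
  field_simp
  ring

theorem edist_partialSumProcess_le {Ω : Type*} (ξ : ℕ → Ω → ℝ) (T : ℕ) (ω : Ω) {s : ℝ}
    (hs : s ∈ Icc (0 : ℝ) 1) :
    edist ((√(T : ℝ))⁻¹ * partialSumProcess ξ T ω s) 0 ≤ ENNReal.ofReal (√(T : ℝ))⁻¹ *
      edist (SkorokhodSpace.ofPath 0 1 (partialSumProcess ξ T ω)) (SkorokhodSpace.ofPath 0 1 0) := by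
  rw [SkorokhodSpace.edist_ofPath_zero (isCadlag_partialSumProcess ξ T ω 0 1), edist_zero_right,
    enorm_mul, Real.enorm_of_nonneg (by positivity)]
  gcongr
  rw [← edist_zero_right]
  exact le_iSup (fun t : Icc (0 : ℝ) 1 => edist (partialSumProcess ξ T ω t) 0) ⟨s, hs⟩

theorem dickeyFullerProcess_eq_comp_natFloor_mul {Ω : Type*} (K : ℝ → ℝ) (h : ℝ) (Y : ℕ → Ω → ℝ)
    (T : ℕ) (ω : Ω) :
    dickeyFullerProcess K h Y T ω = fun s => (fun n : ℕ => ((n : ℝ)⁻¹ * ∑ t ∈ Finset.Icc 1 n,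
      Y (t - 1) ω * (Y t ω - Y (t - 1) ω) * K (((n : ℝ) - (t : ℝ)) / h)) /
        (((n : ℝ) ^ 2)⁻¹ * ∑ t ∈ Finset.Icc 1 n, Y (t - 1) ω ^ 2)) ⌊(T : ℝ) * s⌋₊ := rfl

theorem isCadlag_dickeyFullerProcess {Ω : Type*} (K : ℝ → ℝ) (h : ℝ) (Y : ℕ → Ω → ℝ)
    (T : ℕ) (ω : Ω) (a b : ℝ) : IsCadlag fun t : Icc a b => dickeyFullerProcess K h Y T ω t := by
  rw [dickeyFullerProcess_eq_comp_natFloor_mul]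
  exact isCadlag_comp_natFloor_mul T _

theorem aemeasurable_ofPath_dickeyFullerProcess {Ω : Type*} [MeasurableSpace Ω] {P : Measure Ω}
    (K : ℝ → ℝ) (h : ℝ) {Y : ℕ → Ω → ℝ} (hY : ∀ n, Measurable (Y n)) (T : ℕ) (a b : ℝ) :
    AEMeasurable (fun ω => SkorokhodSpace.ofPath a b (dickeyFullerProcess K h Y T ω)) P := by
  simp_rw [dickeyFullerProcess_eq_comp_natFloor_mul]
  refine SkorokhodSpace.aemeasurable_ofPath_comp_natFloor_mul T
    (fun ω (n : ℕ) => ((n : ℝ)⁻¹ * ∑ t ∈ Finset.Icc 1 n,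
      Y (t - 1) ω * (Y t ω - Y (t - 1) ω) * K (((n : ℝ) - (t : ℝ)) / h)) /
        (((n : ℝ) ^ 2)⁻¹ * ∑ t ∈ Finset.Icc 1 n, Y (t - 1) ω ^ 2)) fun n => ?_
  have h1 : Measurable fun ω => ∑ t ∈ Finset.Icc 1 n,
      Y (t - 1) ω * (Y t ω - Y (t - 1) ω) * K (((n : ℝ) - (t : ℝ)) / h) :=
    Finset.measurable_fun_sum _ fun t _ =>
      ((hY _).mul ((hY _).sub (hY _))).mul_const _
  have h2 : Measurable fun ω => ∑ t ∈ Finset.Icc 1 n, Y (t - 1) ω ^ 2 :=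
    Finset.measurable_fun_sum _ fun t _ => (hY _).pow_const 2
  exact ((h1.const_mul _).div (h2.const_mul _)).aemeasurable

/-- Pathwise convergence of the weighted Dickey-Fuller process, along any filter along which the
partial sum process converges to a continuous path and the squares obey a uniform law of large
numbers. -/
theorem tendsto_ofPath_dickeyFullerProcess {ι Ω : Type*} {l : Filter ι} [l.IsCountablyGenerated]
    {Y ε : ℕ → Ω → ℝ} (hY : IsAR1 1 Y ε) {K : ℝ → ℝ} (hK : ContDiff ℝ 1 K) {C : ℝ}
    (hC : ∀ z, |deriv K z| ≤ C) {h : ℕ → ℝ} (hh : ∀ T, 1 ≤ T → 0 < h T) {ζ κ : ℝ} (hκ : 0 ≤ κ)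
    (hζ : Tendsto (fun T : ℕ => (T : ℝ) / h T) atTop (𝓝 ζ)) {v : ℝ} {m : ℕ → ℝ}
    (hm : ∀ t, 1 ≤ t → m t = v) {w : ℝ → ℝ} (hw : Continuous w)
    (hpos : ∀ s ∈ Icc κ 1, ∫ r in (0 : ℝ)..s, w r ^ 2 ≠ 0)
    {T : ι → ℕ} (hT : Tendsto T l atTop) {ω : ι → Ω}
    (hX : Tendsto (fun i => SkorokhodSpace.ofPath 0 1 (partialSumProcess ε (T i) (ω i))) l
      (𝓝 (SkorokhodSpace.ofPath 0 1 w)))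
    (hR : Tendsto (fun i => ENNReal.ofReal (√(T i : ℝ))⁻¹ * edist (SkorokhodSpace.ofPath 0 1
      (partialSumProcess (fun t ω => ε t ω ^ 2 - m t) (T i) (ω i)))
      (SkorokhodSpace.ofPath 0 1 0)) l (𝓝 0)) :
    Tendsto (fun i => SkorokhodSpace.ofPath κ 1 (dickeyFullerProcess K (h (T i)) Y (T i) (ω i))) l
      (𝓝 (SkorokhodSpace.ofPath κ 1 (pathRatio K ζ w fun r => w r ^ 2 - v * r))) := by
  have hq : Continuous fun r => w r ^ 2 - v * r := by fun_prop
  have hws := SkorokhodSpace.tendstoUniformlyOn_of_tendsto_ofPath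
    (Eventually.of_forall fun i => isCadlag_partialSumProcess ε (T i) (ω i) 0 1) hw.continuousOn hX
  have hqs : TendstoUniformlyOn
      (fun i r => compensatedSquare Y ε (T i) (ω i) ⌊(T i : ℝ) * r⌋₊)
      (fun r => w r ^ 2 - v * r) l (Icc 0 1) := by
    refine tendstoUniformlyOn_of_tendsto_prod_nhdsWithin isCompact_Icc hq.continuousOn
      fun x hx => ?_
    have hmem : ∀ᶠ p : ι × ℝ in l ×ˢ 𝓝[Icc 0 1] x, p.2 ∈ Icc (0 : ℝ) 1 :=
      tendsto_snd.eventually self_mem_nhdsWithin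
    have h1 := hws.tendsto_prod_nhdsWithin hx hw.continuousWithinAt
    have h2 : Tendsto (fun p : ι × ℝ => (√(T p.1 : ℝ))⁻¹ * partialSumProcess
        (fun t ω => ε t ω ^ 2 - m t) (T p.1) (ω p.1) p.2) (l ×ˢ 𝓝[Icc 0 1] x) (𝓝 0) := by
      rw [tendsto_iff_edist_tendsto_0]
      refine tendsto_of_tendsto_of_tendsto_of_le_of_le' tendsto_const_nhds
        (hR.comp tendsto_fst) (Eventually.of_forall fun _ => zero_le) ?_
      filter_upwards [hmem] with p hp
      exact edist_partialSumProcess_le _ _ _ hp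
    have h3 := tendsto_natFloor_mul_div (hT.comp (tendsto_fst (g := 𝓝[Icc 0 1] x)))
      (tendsto_snd.mono_right nhdsWithin_le_nhds) (hmem.mono fun p hp => hp.1)
    have h4 := ((h1.pow 2).sub h2).sub (h3.const_mul v)
    rw [sub_zero] at h4
    refine h4.congr' ?_
    filter_upwards [(hT.comp tendsto_fst).eventually_gt_atTop 0] with p hp
    exact (partialSum_sq_eq_compensatedSquare hY hp v (ω p.1) p.2 hm).symm
  have hmain := tendstoUniformlyOn_stepRatio
    (ws := fun i n => (√(T i : ℝ))⁻¹ * ∑ j ∈ Finset.Icc 1 n, ε j (ω i))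
    hK hC hκ hw hq hpos hT (hζ.comp hT) hws hqs
  have hlim := SkorokhodSpace.tendsto_ofPath
    (Eventually.of_forall fun i => isCadlag_comp_natFloor_mul (T i) _)
    (Continuous.isCadlag (continuousOn_iff_continuous_domRestrict.1
      (continuousOn_pathRatio hK ζ hw hq hpos))) hmain
  refine hlim.congr' ?_
  filter_upwards [hT.eventually_gt_atTop 0] with i hi
  exact SkorokhodSpace.ofPath_congr fun s _ =>
    (dickeyFullerProcess_eq_stepRatio hY K (hh _ hi) hi (ω i) s).symm

theorem mainTheorem1
    {Ω Ω₁ Ω₂ : Type*} [MeasurableSpace Ω] [MeasurableSpace Ω₁] [MeasurableSpace Ω₂]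
    (P : Measure Ω) [IsProbabilityMeasure P]
    (P₁ : Measure Ω₁) [IsProbabilityMeasure P₁]
    (P₂ : Measure Ω₂) [IsProbabilityMeasure P₂]
    (B : ℝ≥0 → Ω₁ → ℝ) (hB : IsBrownianReal B P₁)
    (B₂ : ℝ≥0 → Ω₂ → ℝ) (hB₂ : IsBrownianReal B₂ P₂)
    (ε Y : ℕ → Ω → ℝ) (η η' : ℝ)
    (hE1 : ErrorAssumption ε P η η' B P₁ B₂ P₂)
    (hY : IsAR1 1 Y ε)
    (K : ℝ → ℝ) (hK : KernelAssumption K)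
    (h : ℕ → ℝ) (hh : ∀ T, 1 ≤ T → 0 < h T)
    (ζ : ℝ) (hζ : 1 ≤ ζ) (hζ_lim : Tendsto (fun T : ℕ => (T : ℝ) / h T) atTop (𝓝 ζ))
    (ϑ : ℝ) (hϑ : ϑ = η / √(Var[ε 1; P]))
    (κ : ℝ) (hκ : κ ∈ Ioo (0 : ℝ) 1) :
    WeaklyConverges κ 1 (fun T => dickeyFullerProcess K (h T) Y T) P (limitProcess K ζ ϑ B) P₁ ∧
      ∀ᵐ ω ∂P₁, ContinuousOn (limitProcess K ζ ϑ B ω) (Ioc 0 1) := by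
  have hK1 : ContDiff ℝ 1 K := hK.contDiff.of_le (by norm_num)
  obtain ⟨C, hC⟩ := hK.deriv_bounded
  have hη : η ≠ 0 := hE1.η_pos.ne'
  subst hϑ
  have hv : Var[ε 1; P] = ∫ ω, ε 1 ω ^ 2 ∂P :=
    variance_of_integral_eq_zero (hE1.measurable 1 le_rfl).aemeasurable hE1.mean_zero
  have hm : ∀ t, 1 ≤ t → ∫ ω, ε t ω ^ 2 ∂P = Var[ε 1; P] := fun t ht =>
    (hE1.stationary.integral_sq_eq ht).trans hv.symm
  have hv0 : 0 ≤ Var[ε 1; P] := variance_nonneg _ _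
  generalize Var[ε 1; P] = v at hm hv0
  have hpos : ∀ᵐ ω ∂P₁, ∀ s : ℝ, 0 < s → ∫ r in (0 : ℝ)..s, scaledPath η B ω r ^ 2 ≠ 0 := by
    filter_upwards [hB.ae_integral_sq_pos] with ω hω s hs
    simp only [scaledPath, mul_pow]
    rw [intervalIntegral.integral_const_mul]
    exact mul_ne_zero (pow_ne_zero 2 hη) (hω s hs).ne'
  have hcont : ∀ᵐ ω ∂P₁, ContinuousOn (limitProcess K ζ (η / √v) B ω) (Ioc 0 1) := by
    filter_upwards [hB.cont, hpos] with ω hc hω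
    have hw := continuous_scaledPath hc η
    exact (continuousOn_pathRatio hK1 ζ hw (by fun_prop) fun s hs => hω s hs.1).congr
      fun s hs => limitProcess_eq_pathRatio hK1 hc hη hv0 ζ hs.1.ne'
  refine ⟨?_, hcont⟩
  have hsub : Icc κ 1 ⊆ Ioc 0 1 := fun s hs => ⟨hκ.1.trans_le hs.1, hs.2⟩
  have hYm : ∀ n, Measurable (Y n) := fun n => by
    rw [funext (hY.eq_sum n)]
    exact Finset.measurable_fun_sum _ fun i hi => hE1.measurable i (Finset.mem_Icc.1 hi).1
  refine ⟨fun T => Eventually.of_forall fun ω => isCadlag_dickeyFullerProcess _ _ _ _ _ _ _,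
    ?_, ?_⟩
  · filter_upwards [hcont] with ω hω
    exact Continuous.isCadlag (continuousOn_iff_continuous_domRestrict.1 (hω.mono hsub))
  -- `R` is `T^{-1/2}` times the sup norm of the partial sum process of the centred squares.
  refine hE1.fclt.tendsto.of_tendsto_comap (R := fun T ω => ENNReal.ofReal (√(T : ℝ))⁻¹ *
      edist (SkorokhodSpace.ofPath 0 1
        (partialSumProcess (fun t ω => ε t ω ^ 2 - ∫ ω', ε t ω' ^ 2 ∂P) T ω))
        (SkorokhodSpace.ofPath 0 1 0))
    (fun T => aemeasurable_ofPath_dickeyFullerProcess K (h T) hYm T κ 1)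
    (aemeasurable_ofPath_limitProcess hB hK1 hC ζ hη hv0 hκ.1) (fun δ hδ => ?_) ?_
  · refine tendsto_measure_le_inv_sqrt_mul_edist hE1.fclt_sq.tendsto _ ?_ hδ
    filter_upwards [hB₂.cont] with ω hc
    have hw := continuous_scaledPath hc η'
    rw [SkorokhodSpace.edist_ofPath_zero (hw.comp continuous_subtype_val).isCadlag]
    obtain ⟨M, hM⟩ := isCompact_Icc.exists_bound_of_continuousOn (s := Icc (0 : ℝ) 1)
      hw.continuousOn
    refine ((iSup_le fun t => ?_).trans_lt (ENNReal.ofReal_lt_top (r := M))).ne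
    rw [edist_zero_right, ← ofReal_norm]
    exact ENNReal.ofReal_le_ofReal (hM t t.2)
  · filter_upwards [hB.cont, hpos] with ω' hc hω'
    rw [SkorokhodSpace.ofPath_congr fun t ht =>
      limitProcess_eq_pathRatio hK1 hc hη hv0 ζ (hsub ht).1.ne']
    -- The index set is `ℕ × Ω`, so the sample point varies along the filter together with `T`.
    exact tendsto_ofPath_dickeyFullerProcess (ω := Prod.snd) hY hK1 hC hh hκ.1.le hζ_lim hm
      (continuous_scaledPath hc η) (fun s hs => hω' s (hsub hs).1)
      (tendsto_comap.mono_left (inf_le_left.trans inf_le_left))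
      (tendsto_comap.mono_left (inf_le_left.trans inf_le_right))
      (tendsto_comap.mono_left inf_le_right)
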